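/- For a complex number $a\notin\{0,-1,-2,\dots\}$ and an integer $s\ge 2$ let $\zeta(s,a)=\sum_{k=0}^{\infty}\frac{1}{(a+k)^{s}}$ be the Hurwitz zeta function, and let $\psi=\Gamma'/\Gamma$ be the digamma function. **Theorem (recursion formula for $\zeta(2m,a)$).** Let $a\in\mathbb{C}$ with $a\neq 0,-\tfrac12,-1,-\tfrac32,\dots$ (that is, $2a\notin\{0,-1,-2,\dots\}$). Then for every integer $m\ge 1$ the series on the right-hand side below converges and $$\Bigl(m+\tfrac12\Bigr)\zeta(2m+2,a)-\sum_{i=1}^{m}\zeta(2i,a)\,\zeta(2m-2i+2,a)=\sum_{k=0}^{\infty}\frac{\psi(1+k)-\psi(2a+k)}{(a+k)^{2m+1}}.$$ -/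

import Mathlib

/-- The Hurwitz zeta function `ζ(s, a) = ∑_{k ≥ 0} 1 / (a + k) ^ s` at an integer `s ≥ 2`,
for a complex parameter `a` that is not one of `0, -1, -2, …`. (Mathlib's `hurwitzZeta` only takes
a parameter in `ℝ / ℤ`.) -/
noncomputable def hurwitzZetaInt (s : ℕ) (a : ℂ) : ℂ :=
  ∑' k : ℕ, 1 / (a + (k : ℂ)) ^ s

/-- The series defining `hurwitzZetaInt s a` converges for every integer `s ≥ 2`. -/
theorem hasSum_hurwitzZetaInt {s : ℕ} (hs : 2 ≤ s) (a : ℂ) :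
    HasSum (fun k : ℕ => 1 / (a + (k : ℂ)) ^ s) (hurwitzZetaInt s a) := by
  refine Summable.hasSum ?_
  refine summable_of_isBigO_nat (Real.summable_one_div_nat_pow.mpr hs) ?_
  refine Asymptotics.IsBigO.of_bound ((2 : ℝ) ^ s) ?_
  obtain ⟨N, hN⟩ := exists_nat_ge (2 * ‖a‖ + 1)
  filter_upwards [Filter.eventually_ge_atTop N] with k hk
  have hk' : (N : ℝ) ≤ k := by exact_mod_cast hk
  have h0 : 0 ≤ ‖a‖ := norm_nonneg a
  have hkpos : (0 : ℝ) < k := by linarith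
  have h1 : (k : ℝ) / 2 ≤ ‖a + (k : ℂ)‖ := by
    have h2 : ‖(k : ℂ)‖ ≤ ‖a + (k : ℂ)‖ + ‖a‖ := by
      calc ‖(k : ℂ)‖ = ‖(a + (k : ℂ)) - a‖ := by congr 1; ring
        _ ≤ _ := norm_sub_le _ _
    rw [Complex.norm_natCast] at h2
    linarith
  have h3 : ((k : ℝ) / 2) ^ s ≤ ‖a + (k : ℂ)‖ ^ s := by gcongr
  have h4 : (0 : ℝ) < ((k : ℝ) / 2) ^ s := by positivity
  calc ‖1 / (a + (k : ℂ)) ^ s‖ = 1 / ‖a + (k : ℂ)‖ ^ s := by simp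
    _ ≤ 1 / ((k : ℝ) / 2) ^ s := one_div_le_one_div_of_le h4 h3
    _ = (2 : ℝ) ^ s * ‖1 / (k : ℝ) ^ s‖ := by
      rw [Real.norm_of_nonneg (by positivity), div_pow]
      field_simp

open Filter Topology

/-! Put `x k = a + k` and cut every series off at `N`. Off the diagonal `k ≠ j`, the sum over `i` of
`x k ^ (-2i) * x j ^ (-(2m-2i+2))` is geometric, and partial fractions give it denominators `x j - x
k = j - k` and `x k + x j = 2a + k + j`. The diagonal supplies the zeta term. This gives an exact
identity between finite sums (`sum_mul_sum_inv_pow`), with weights `(a + k) ^ (-(2m+1))` on the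
bracket `∑ 1/(2a+k+j) - ∑ 1/(j-k)` over `j < N`.

As `N → ∞` the bracket tends to `ψ(1+k) - ψ(2a+k)`, because `ψ(w+N) - ψ(1+N) → 0`
(`tendsto_digamma_sub`). For `k < N` it is `O(√(k+1))` uniformly in `N`
(`exists_norm_sum_range_bracket_le`), so dominated convergence for series gives both the convergence
and the value. -/

/-! ### Asymptotics of the digamma function under integer shifts -/

theorem Complex.digamma_ofReal {x : ℝ} (hx : 0 < x) :
    Complex.digamma x = (deriv (Real.log ∘ Real.Gamma) x : ℝ) := by
  have hd : DifferentiableAt ℝ Real.Gamma x :=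
    Real.differentiableAt_Gamma fun m ↦ by have : (0 : ℝ) ≤ m := m.cast_nonneg; linarith
  have hdc : DifferentiableAt ℂ Complex.Gamma x := Complex.differentiableAt_Gamma _ fun m h ↦ by
    have h' : x = -(m : ℝ) := by exact_mod_cast h
    have : (0 : ℝ) ≤ m := m.cast_nonneg
    linarith
  have h1 := hdc.hasDerivAt.comp_ofReal
  have h2 : HasDerivAt (fun y : ℝ ↦ Complex.Gamma y) ((deriv Real.Gamma x : ℝ) : ℂ) x := by
    simpa only [Complex.Gamma_ofReal] using hd.hasDerivAt.ofReal_comp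
  rw [Complex.digamma_def, logDeriv_apply, h1.unique h2, Complex.Gamma_ofReal, Function.comp_def,
    deriv.log hd (Real.Gamma_pos_of_pos hx).ne', Complex.ofReal_div]

theorem Complex.digamma_add_natCast {w : ℂ} (hw : ∀ n : ℕ, w ≠ -n) (N : ℕ) :
    Complex.digamma (w + N) = Complex.digamma w + ∑ j ∈ Finset.range N, 1 / (w + j) := by
  induction N with
  | zero => simp
  | succ N ih =>
    rw [Nat.cast_succ, ← add_assoc, Complex.digamma_apply_add_one, ih, Finset.sum_range_succ,
      one_div, add_assoc]
    intro n h
    refine hw (n + N) ?_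
    push_cast
    linear_combination h

theorem Complex.one_add_ne_neg_natCast (k n : ℕ) : (1 + k : ℂ) ≠ -n := by
  intro h
  have h' : (1 + k + n : ℂ) = 0 := by linear_combination h
  norm_cast at h'
  omega

theorem Complex.natCast_one_ne_neg (n : ℕ) : (1 : ℂ) ≠ -n := by
  simpa using Complex.one_add_ne_neg_natCast 0 n

/-- Log-convexity of `Γ` makes `ψ` increasing on the positive reals, so the difference lies between
`0` and `ψ(2+N) - ψ(1+N) = 1/(1+N)`. -/
theorem tendsto_digamma_sub_of_mem_Icc {x : ℝ} (hx : x ∈ Set.Icc (1 : ℝ) 2) :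
    Tendsto (fun N : ℕ ↦ Complex.digamma (x + N) - Complex.digamma (1 + N)) atTop (𝓝 0) := by
  obtain ⟨h1, h2⟩ := hx
  set g : ℝ → ℝ := deriv (Real.log ∘ Real.Gamma)
  have hmono : MonotoneOn g (Set.Ioi 0) := by
    refine Real.convexOn_log_Gamma.monotoneOn_deriv fun y hy ↦ ?_
    have hy : 0 < y := hy
    exact (Real.differentiableAt_Gamma fun m ↦ by
      have : (0 : ℝ) ≤ m := m.cast_nonneg; linarith).log (Real.Gamma_pos_of_pos hy).ne'
  have hg (y : ℝ) (hy : 0 < y) (N : ℕ) : Complex.digamma (y + N) = (g (y + N) : ℝ) := by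
    rw [← Complex.digamma_ofReal (by positivity)]; push_cast; rfl
  have hstep (N : ℕ) : g (2 + N) = g (1 + N) + 1 / (1 + N) := by
    have h := Complex.digamma_apply_add_one (1 + N) (Complex.one_add_ne_neg_natCast N)
    have e1 := hg 1 one_pos N
    have e2 := hg 2 two_pos N
    push_cast at e1 e2
    rw [show (1 + N + 1 : ℂ) = 2 + N by ring, e1, e2] at h
    apply Complex.ofReal_injective
    push_cast
    rw [h, one_div]
  have hlim : Tendsto (fun N : ℕ ↦ g (x + N) - g (1 + N)) atTop (𝓝 0) := by
    refine squeeze_zero (fun N ↦ ?_) (fun N ↦ ?_) tendsto_one_div_add_atTop_nhds_zero_nat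
    · have hN : (0 : ℝ) ≤ N := N.cast_nonneg
      exact sub_nonneg.2 (hmono (by simp only [Set.mem_Ioi]; linarith)
        (by simp only [Set.mem_Ioi]; linarith) (by linarith))
    · have hN : (0 : ℝ) ≤ N := N.cast_nonneg
      have := hmono (a := x + N) (b := 2 + N) (by simp only [Set.mem_Ioi]; linarith)
        (by simp only [Set.mem_Ioi]; linarith) (by linarith)
      rw [hstep] at this
      rw [add_comm (N : ℝ) 1]
      linarith
  have := (Complex.continuous_ofReal.tendsto 0).comp hlim
  simp only [Complex.ofReal_zero] at this
  refine this.congr fun N ↦ ?_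
  have e1 := hg 1 one_pos N
  push_cast at e1
  rw [hg x (by linarith), e1]
  simp

theorem tendsto_digamma_sub_iff {w : ℂ} (hw : ∀ n : ℕ, w ≠ -n) :
    Tendsto (fun N : ℕ ↦ Complex.digamma (w + N) - Complex.digamma (1 + N)) atTop (𝓝 0) ↔
      Tendsto (fun N : ℕ ↦ ∑ j ∈ Finset.range N, (1 / (w + j) - 1 / (1 + j))) atTop
        (𝓝 (Complex.digamma 1 - Complex.digamma w)) := by
  have key (N : ℕ) : ∑ j ∈ Finset.range N, (1 / (w + j) - 1 / (1 + j)) =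
      (Complex.digamma (w + N) - Complex.digamma (1 + N)) +
        (Complex.digamma 1 - Complex.digamma w) := by
    rw [Complex.digamma_add_natCast hw, Complex.digamma_add_natCast Complex.natCast_one_ne_neg,
      Finset.sum_sub_distrib]
    ring
  simp only [key]
  constructor
  · intro h
    simpa using h.add_const (Complex.digamma 1 - Complex.digamma w)
  · intro h
    simpa using h.sub_const (Complex.digamma 1 - Complex.digamma w)

/-- Identity theorem: the series `∑ (1/(z+j) - 1/(1+j))` and `ψ(1) - ψ(z)` are both holomorphic, and
they agree on the real interval `(1, 2)` by the monotonicity argument. -/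
theorem tendsto_digamma_sub_of_one_lt_re {w : ℂ} (hw : 1 < w.re) :
    Tendsto (fun N : ℕ ↦ Complex.digamma (w + N) - Complex.digamma (1 + N)) atTop (𝓝 0) := by
  set R : ℝ := ‖w‖ + 2
  -- The ball bounds `‖1 - z‖` by `1 + R`, which makes the Weierstrass majorant `u` uniform on `U`;
  -- convexity gives connectedness.
  set U : Set ℂ := {z | 1 < z.re} ∩ Metric.ball 0 R
  have hUo : IsOpen U := (isOpen_lt continuous_const Complex.continuous_re).inter Metric.isOpen_ball
  have hUc : IsPreconnected U :=
    ((convex_halfSpace_re_gt 1).inter (convex_ball 0 R)).isPreconnected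
  have hU0 {z : ℂ} (hz : z ∈ U) (n : ℕ) : z ≠ -n := by
    intro h
    have h1 : 1 < z.re := hz.1
    have h2 : z.re = -(n : ℝ) := by simp [h]
    have : (0 : ℝ) ≤ n := n.cast_nonneg
    linarith
  have hne {z : ℂ} (hz : z ∈ U) (n : ℕ) : z + n ≠ 0 := fun h ↦
    hU0 hz n (eq_neg_of_add_eq_zero_left h)
  set u : ℕ → ℝ := fun j ↦ (1 + R) * (1 / ((j : ℝ) + 1) ^ 2)
  have hu : Summable u := by
    refine Summable.mul_left _ ?_
    have := (summable_nat_add_iff 1).2 (Real.summable_one_div_nat_pow.2 one_lt_two)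
    simpa using this
  have hle (j : ℕ) (z : ℂ) (hz : z ∈ U) : ‖1 / (z + j) - 1 / (1 + j : ℂ)‖ ≤ u j := by
    have hj1 : (1 + j : ℂ) ≠ 0 := by
      simpa using Complex.one_add_ne_neg_natCast j 0
    have hj : (0 : ℝ) ≤ j := j.cast_nonneg
    have hz1 : 1 < z.re := hz.1
    have hz2 : ‖z‖ < R := by simpa using hz.2
    have h1 : (j : ℝ) + 1 ≤ ‖z + j‖ := by
      refine le_trans ?_ (Complex.re_le_norm _)
      simp only [Complex.add_re, Complex.natCast_re]; linarith
    have h2 : ‖(1 + j : ℂ)‖ = j + 1 := by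
      rw [add_comm]; exact_mod_cast Complex.norm_natCast (j + 1)
    have h3 : ‖1 - z‖ ≤ 1 + R := (norm_sub_le _ _).trans (by simp; linarith)
    rw [div_sub_div _ _ (hne hz j) hj1, norm_div, norm_mul, h2,
      show (1 * (1 + j) - (z + j) * 1 : ℂ) = 1 - z by ring]
    calc ‖1 - z‖ / (‖z + j‖ * (j + 1)) ≤ (1 + R) / ((j + 1) * (j + 1)) := by gcongr
      _ = u j := by simp only [u]; ring
  have hdF : DifferentiableOn ℂ (fun z : ℂ ↦ ∑' j : ℕ, (1 / (z + j) - 1 / (1 + j : ℂ))) U := by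
    refine Complex.differentiableOn_tsum_of_summable_norm hu (fun j z hz ↦ ?_) hUo hle
    have := hne hz j
    exact DifferentiableAt.differentiableWithinAt (by fun_prop (disch := assumption))
  have hdG : DifferentiableOn ℂ (fun z : ℂ ↦ Complex.digamma 1 - Complex.digamma z) U := by
    refine (differentiableOn_const _).sub fun z hz ↦ ?_
    have h1 : DifferentiableOn ℂ Complex.Gamma U := fun y hy ↦
      (Complex.differentiableAt_Gamma y (hU0 hy)).differentiableWithinAt
    exact ((h1.deriv hUo z hz).div (h1 z hz) (Complex.Gamma_ne_zero (hU0 hz)))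
  have hsum {z : ℂ} (hz : z ∈ U) := (Summable.of_norm_bounded hu (hle · z hz)).hasSum.tendsto_sum_nat
  have hreal (x : ℝ) (hx : x ∈ Set.Ioo (1 : ℝ) 2) : (x : ℂ) ∈ U := by
    refine ⟨by simpa using hx.1, ?_⟩
    simp only [Metric.mem_ball, dist_zero_right, Complex.norm_real, Real.norm_eq_abs, R]
    rw [abs_of_pos (by linarith [hx.1])]
    linarith [hx.2, norm_nonneg w]
  have h0 : ((3 / 2 : ℝ) : ℂ) ∈ U := hreal _ (by norm_num)
  have hfreq : ∃ᶠ z in 𝓝[≠] ((3 / 2 : ℝ) : ℂ),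
      ∑' j : ℕ, (1 / (z + j) - 1 / (1 + j : ℂ)) = Complex.digamma 1 - Complex.digamma z := by
    have hmap : Tendsto (fun x : ℝ ↦ (x : ℂ)) (𝓝[≠] (3 / 2)) (𝓝[≠] ((3 / 2 : ℝ) : ℂ)) :=
      (Complex.continuous_ofReal.continuousWithinAt).tendsto_nhdsWithin
        fun x hx h ↦ hx (Complex.ofReal_injective h)
    refine hmap.frequently (Eventually.frequently ?_)
    have hm : Set.Ioo (1 : ℝ) 2 ∈ 𝓝[≠] (3 / 2 : ℝ) :=
      mem_nhdsWithin_of_mem_nhds (Ioo_mem_nhds (by norm_num) (by norm_num))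
    filter_upwards [hm] with x hx
    exact tendsto_nhds_unique (hsum (hreal x hx)) ((tendsto_digamma_sub_iff (hU0 (hreal x hx))).1
      (tendsto_digamma_sub_of_mem_Icc ⟨hx.1.le, hx.2.le⟩))
  have heq := (hdF.analyticOnNhd hUo).eqOn_of_preconnected_of_frequently_eq
    (hdG.analyticOnNhd hUo) hUc h0 hfreq
  have hwU : w ∈ U := ⟨hw, by simp [R]⟩
  have hw_eq := heq hwU
  dsimp only at hw_eq
  rw [tendsto_digamma_sub_iff (hU0 hwU), ← hw_eq]
  exact hsum hwU

theorem tendsto_digamma_sub {w : ℂ} (hw : ∀ n : ℕ, w ≠ -n) :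
    Tendsto (fun N : ℕ ↦ Complex.digamma (w + N) - Complex.digamma (1 + N)) atTop (𝓝 0) := by
  obtain ⟨n, hn⟩ := exists_nat_gt (1 - w.re)
  induction n generalizing w with
  | zero => exact tendsto_digamma_sub_of_one_lt_re (by norm_num at hn; linarith)
  | succ n ih =>
    have hw1 (k : ℕ) : w + 1 ≠ -k := fun h ↦ hw (k + 1) (by push_cast; linear_combination h)
    have h := ih hw1 (by push_cast at hn; simp; linarith)
    -- Passing from `w + 1` back to `w` shifts `N` by one, at the cost of a term `1/(N+1) → 0`.
    rw [← tendsto_add_atTop_iff_nat 1]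
    have h2 := (tendsto_one_div_add_atTop_nhds_zero_nat (𝕜 := ℂ))
    have h3 := h.sub h2
    rw [sub_zero] at h3
    refine h3.congr fun N ↦ ?_
    have e := Complex.digamma_apply_add_one (1 + N) (Complex.one_add_ne_neg_natCast N)
    push_cast
    rw [← add_assoc 1 (N : ℂ) 1, e, show w + (N + 1) = w + 1 + N by ring]
    ring

/-! ### The finite identity -/

/-- The geometric sum is `(x ^ (-2m) - y ^ (-2m)) / (y² - x²)`. The factor `1/(y² - x²)` is then
split as `(1/(y-x) - 1/(y+x)) / (2x)` in the first term, and symmetrically in the second. -/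
theorem sum_Icc_inv_pow_mul_inv_pow {K : Type*} [Field K] [CharZero K] {x y : K} (hx : x ≠ 0)
    (hy : y ≠ 0) (hxy : x + y ≠ 0) (hne : x ≠ y) (m : ℕ) :
    ∑ i ∈ Finset.Icc 1 m, 1 / x ^ (2 * i) * (1 / y ^ (2 * m - 2 * i + 2)) =
      1 / x ^ (2 * m + 1) / 2 * (1 / (y - x) - 1 / (x + y)) +
        1 / y ^ (2 * m + 1) / 2 * (1 / (x - y) - 1 / (y + x)) := by
  have h1 : y - x ≠ 0 := sub_ne_zero.2 hne.symm
  have h2 : x - y ≠ 0 := sub_ne_zero.2 hne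
  have h3 : y + x ≠ 0 := by rwa [add_comm]
  have hu : (x ^ 2)⁻¹ - (y ^ 2)⁻¹ ≠ 0 := by
    rw [inv_sub_inv (pow_ne_zero 2 hx) (pow_ne_zero 2 hy)]
    refine div_ne_zero ?_ (mul_ne_zero (pow_ne_zero 2 hx) (pow_ne_zero 2 hy))
    rw [sq_sub_sq]
    exact mul_ne_zero h3 h1
  have hgeom := geom_sum₂_mul (x ^ 2)⁻¹ (y ^ 2)⁻¹ m
  have hs : ∑ i ∈ Finset.Icc 1 m, 1 / x ^ (2 * i) * (1 / y ^ (2 * m - 2 * i + 2)) =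
      (x ^ 2)⁻¹ * (y ^ 2)⁻¹ *
        ∑ i ∈ Finset.range m, (x ^ 2)⁻¹ ^ i * (y ^ 2)⁻¹ ^ (m - 1 - i) := by
    rw [← Finset.Ico_add_one_right_eq_Icc, Finset.sum_Ico_eq_sum_range, Finset.mul_sum]
    refine Finset.sum_congr (by simp) fun i hi ↦ ?_
    have hi' : i < m := by simpa using hi
    rw [show 2 * m - 2 * (1 + i) + 2 = 2 * (m - 1 - i) + 2 by omega]
    simp only [one_div, ← inv_pow, ← pow_mul]
    ring
  rw [hs, eq_div_of_mul_eq hu hgeom]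
  rw [inv_pow, inv_pow, ← pow_mul, ← pow_mul, inv_sub_inv (pow_ne_zero 2 hx) (pow_ne_zero 2 hy),
    show y ^ 2 - x ^ 2 = (y - x) * (y + x) by ring, pow_succ, pow_succ,
    show x - y = -(y - x) by ring, add_comm x y]
  field_simp
  ring

theorem sum_mul_sum_inv_pow {K : Type*} [Field K] [CharZero K] {x : ℕ → K}
    (hadd : ∀ j k, x j + x k ≠ 0) (hinj : Function.Injective x) (m N : ℕ) :
    ∑ i ∈ Finset.Icc 1 m, (∑ k ∈ Finset.range N, 1 / x k ^ (2 * i)) *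
        (∑ k ∈ Finset.range N, 1 / x k ^ (2 * m - 2 * i + 2)) =
      ((m : K) + 1 / 2) * ∑ k ∈ Finset.range N, 1 / x k ^ (2 * m + 2) +
        ∑ k ∈ Finset.range N, 1 / x k ^ (2 * m + 1) *
          (∑ j ∈ Finset.range N, 1 / (x j - x k) - ∑ j ∈ Finset.range N, 1 / (x k + x j)) := by
  have hx (k : ℕ) : x k ≠ 0 := fun h ↦ hadd k k (by simp [h])
  set P : ℕ → ℕ → K := fun k j ↦ 1 / x k ^ (2 * m + 1) / 2 * (1 / (x j - x k) - 1 / (x k + x j))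
  -- On the diagonal `1 / (x k - x k) = 0` by convention, so `2 * P k k = -(1/2) / x k ^ (2m+2)`.
  -- The true value `m / x k ^ (2m+2)` thus needs the coefficient `m + 1/2`.
  have hT (k j : ℕ) : ∑ i ∈ Finset.Icc 1 m, 1 / x k ^ (2 * i) * (1 / x j ^ (2 * m - 2 * i + 2)) =
      P k j + P j k + if k = j then ((m : K) + 1 / 2) * (1 / x k ^ (2 * m + 2)) else 0 := by
    by_cases h : k = j
    · subst h
      have : ∀ i ∈ Finset.Icc 1 m,
          1 / x k ^ (2 * i) * (1 / x k ^ (2 * m - 2 * i + 2)) = 1 / x k ^ (2 * m + 2) := by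
        intro i hi
        have := (Finset.mem_Icc.1 hi).2
        rw [div_mul_div_comm, ← pow_add, one_mul]
        congr 2
        omega
      rw [Finset.sum_congr rfl this, if_pos rfl]
      simp only [Finset.sum_const, Nat.card_Icc, add_tsub_cancel_right, nsmul_eq_mul, P, sub_self,
        div_zero, zero_sub, ← two_mul]
      have := hx k
      field_simp
      ring
    · rw [if_neg h, add_zero,
        sum_Icc_inv_pow_mul_inv_pow (hx k) (hx j) (hadd k j) (hinj.ne h)]
  have hP (k : ℕ) : 1 / x k ^ (2 * m + 1) *
      (∑ j ∈ Finset.range N, 1 / (x j - x k) - ∑ j ∈ Finset.range N, 1 / (x k + x j)) =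
      2 * ∑ j ∈ Finset.range N, P k j := by
    rw [← Finset.sum_sub_distrib, Finset.mul_sum, Finset.mul_sum]
    refine Finset.sum_congr rfl fun j _ ↦ ?_
    simp only [P]
    ring
  simp only [hP, ← Finset.mul_sum]
  calc _ = ∑ k ∈ Finset.range N, ∑ j ∈ Finset.range N,
        ∑ i ∈ Finset.Icc 1 m, 1 / x k ^ (2 * i) * (1 / x j ^ (2 * m - 2 * i + 2)) := by
        simp only [Finset.sum_mul_sum]
        rw [Finset.sum_comm]
        exact Finset.sum_congr rfl fun k _ ↦ Finset.sum_comm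
    _ = _ := by
        simp only [hT, Finset.sum_add_distrib, Finset.sum_ite_eq]
        rw [Finset.sum_comm (f := fun k j ↦ P j k), Finset.mul_sum,
          Finset.sum_congr rfl fun k hk ↦ if_pos hk]
        ring

/-! ### The inner sums: limit and uniform bound -/

/-- The term `j = k` is `1 / 0 = 0`. Reflection turns the terms below it into minus a harmonic sum.
-/
theorem sum_range_one_div_sub {K : Type*} [Field K] [CharZero K] {k N : ℕ} (h : k < N) :
    ∑ j ∈ Finset.range N, 1 / ((j : K) - k) =
      ∑ j ∈ Finset.range (N - 1 - k), 1 / (1 + j : K) - ∑ j ∈ Finset.range k, 1 / (1 + j : K) := by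
  obtain ⟨M, rfl⟩ : ∃ M, N = (k + 1) + M := ⟨N - (k + 1), by omega⟩
  rw [Finset.sum_range_add, Finset.sum_range_succ, sub_self, div_zero, add_zero,
    show k + 1 + M - 1 - k = M by omega, sub_eq_neg_add, ← Finset.sum_range_reflect,
    ← Finset.sum_neg_distrib]
  congr 1
  · refine Finset.sum_congr rfl fun j hj ↦ ?_
    have : j + 1 ≤ k := Finset.mem_range.1 hj
    rw [show k - 1 - j = k - (j + 1) by omega, Nat.cast_sub this, ← div_neg]
    congr 1
    push_cast
    ring
  · refine Finset.sum_congr rfl fun j _ ↦ ?_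
    congr 1
    push_cast
    ring

/-- The quotient `(n+1)/(z+n) = 1 + (1-z)/(z+n)` converges, hence is bounded. -/
theorem exists_pos_mul_le_norm_add_natCast {z : ℂ} (hz : ∀ n : ℕ, z ≠ -n) :
    ∃ c > 0, ∀ n : ℕ, c * (n + 1) ≤ ‖z + n‖ := by
  have hne (n : ℕ) : z + n ≠ 0 := fun h ↦ hz n (eq_neg_of_add_eq_zero_left h)
  have hinv : Tendsto (fun n : ℕ ↦ (z + n)⁻¹) atTop (𝓝 0) :=
    tendsto_inv₀_cobounded.comp
      ((tendsto_const_add_cobounded z).comp tendsto_natCast_atTop_cobounded)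
  have hlim : Tendsto (fun n : ℕ ↦ ‖1 + (1 - z) * (z + n)⁻¹‖) atTop (𝓝 ‖1 + (1 - z) * 0‖) :=
    ((hinv.const_mul _).const_add _).norm
  obtain ⟨B, hB⟩ := hlim.bddAbove_range
  refine ⟨(max B 1)⁻¹, by positivity, fun n ↦ ?_⟩
  have h1 : ‖1 + (1 - z) * (z + n)⁻¹‖ ≤ B := hB ⟨n, rfl⟩
  have h2 : 1 + (1 - z) * (z + n)⁻¹ = ((n + 1 : ℕ) : ℂ) / (z + n) := by
    have := hne n
    field_simp
    push_cast
    ring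
  rw [h2, norm_div, Complex.norm_natCast, div_le_iff₀ (norm_pos_iff.2 (hne n))] at h1
  rw [inv_mul_le_iff₀ (by positivity)]
  push_cast at h1
  exact h1.trans (by gcongr; exact le_max_left _ _)

/-- A square root in place of a logarithm suffices: the weights decay at least like `(k+1) ^ (-3)`.
-/
theorem sum_range_one_div_one_add_le (n : ℕ) :
    ∑ j ∈ Finset.range n, 1 / (1 + j : ℝ) ≤ 2 * √n := by
  induction n with
  | zero => simp
  | succ n ih =>
    rw [Finset.sum_range_succ]
    have h0 : 0 ≤ √(n : ℝ) := Real.sqrt_nonneg _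
    have h1 : √(n : ℝ) ^ 2 = n := Real.sq_sqrt (by positivity)
    have h2 : √((n + 1 : ℕ) : ℝ) ^ 2 = n + 1 := by
      rw [Real.sq_sqrt (by positivity)]; push_cast; ring
    have h3 : √(n : ℝ) ≤ √((n + 1 : ℕ) : ℝ) := Real.sqrt_le_sqrt (by simp)
    have h4 : 0 < √((n + 1 : ℕ) : ℝ) := by positivity
    have : 1 / (1 + n : ℝ) ≤ 2 * (√((n + 1 : ℕ) : ℝ) - √n) := by
      rw [add_comm, ← h2, div_le_iff₀ (by positivity)]
      have e : (√((n + 1 : ℕ) : ℝ) - √n) * (√((n + 1 : ℕ) : ℝ) + √n) = 1 := by linarith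
      have h5 : 1 ≤ √((n + 1 : ℕ) : ℝ) := by nlinarith [(Nat.cast_nonneg n : (0 : ℝ) ≤ n)]
      nlinarith [mul_nonneg (sub_nonneg.2 h3) (sub_nonneg.2 h3), mul_nonneg (sub_nonneg.2 h3) h0,
        mul_nonneg (mul_nonneg (sub_nonneg.2 h3) h4.le) (sub_nonneg.2 h5)]
    linarith

/-- A block of `2k+1` consecutive harmonic terms is largest at the start of the series, which makes
the bound independent of `N`. -/
theorem sum_range_sub_sum_range_le {k N : ℕ} (h : k < N) :
    ∑ j ∈ Finset.range (N + k), 1 / (1 + j : ℝ) - ∑ j ∈ Finset.range (N - 1 - k), 1 / (1 + j : ℝ) ≤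
      2 * √((2 * k + 1 : ℕ) : ℝ) := by
  rw [show N + k = (N - 1 - k) + (2 * k + 1) by omega, Finset.sum_range_add, add_sub_cancel_left]
  refine le_trans (Finset.sum_le_sum fun j _ ↦ ?_) (sum_range_one_div_one_add_le _)
  gcongr
  simp

theorem norm_sum_range_sub_le {z : ℂ} {c : ℝ} (hc : 0 < c) (h : ∀ n : ℕ, c * (n + 1) ≤ ‖z + n‖)
    (k N : ℕ) :
    ‖∑ j ∈ Finset.range N, (1 / (z + k + j) - 1 / (1 + k + j))‖ ≤
      ‖1 - z‖ / c * ∑' n : ℕ, 1 / ((n : ℝ) + 1) ^ 2 := by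
  have hs : Summable fun n : ℕ ↦ 1 / ((n : ℝ) + 1) ^ 2 := by
    simpa using (summable_nat_add_iff 1).2 (Real.summable_one_div_nat_pow.2 one_lt_two)
  have hterm (n : ℕ) : ‖1 / (z + n) - 1 / (1 + n : ℂ)‖ ≤ ‖1 - z‖ / c * (1 / ((n : ℝ) + 1) ^ 2) := by
    have h1 : ‖(1 + n : ℂ)‖ = n + 1 := by
      rw [add_comm]; exact_mod_cast Complex.norm_natCast (n + 1)
    have h2 : (1 + n : ℂ) ≠ 0 := by rw [← norm_pos_iff, h1]; positivity
    have h3 : z + n ≠ 0 := by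
      rw [← norm_pos_iff]; exact lt_of_lt_of_le (by positivity) (h n)
    rw [div_sub_div _ _ h3 h2, norm_div, norm_mul, h1,
      show (1 * (1 + n) - (z + n) * 1 : ℂ) = 1 - z by ring]
    calc ‖1 - z‖ / (‖z + n‖ * (n + 1)) ≤ ‖1 - z‖ / (c * (n + 1) * (n + 1)) := by
          gcongr
          exact h n
      _ = _ := by field_simp
  calc ‖∑ j ∈ Finset.range N, (1 / (z + k + j) - 1 / (1 + k + j))‖
      ≤ ∑ j ∈ Finset.range N, ‖1 - z‖ / c * (1 / ((j : ℝ) + 1) ^ 2) := by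
        refine norm_sum_le_of_le _ fun j _ ↦ ?_
        have := hterm (k + j)
        push_cast at this
        rw [← add_assoc, ← add_assoc] at this
        refine this.trans ?_
        gcongr
        linarith [(Nat.cast_nonneg k : (0 : ℝ) ≤ k)]
    _ ≤ _ := by
        rw [← Finset.mul_sum]
        gcongr
        exact hs.sum_le_tsum _ fun n _ ↦ by positivity

theorem summable_sqrt_mul_one_div_pow (C : ℝ) :
    Summable fun k : ℕ ↦ C * √((k : ℝ) + 1) * (1 / ((k : ℝ) + 1) ^ 3) := by
  have h : Summable fun k : ℕ ↦ C * (1 / ((k + 1 : ℕ) : ℝ) ^ (5 / 2 : ℝ)) :=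
    ((summable_nat_add_iff 1).2 (Real.summable_one_div_nat_rpow.2 (by norm_num))).mul_left C
  refine h.congr fun k ↦ ?_
  have hk : (0 : ℝ) < (k : ℝ) + 1 := by positivity
  rw [mul_assoc]
  congr 1
  push_cast
  rw [Real.sqrt_eq_rpow, one_div (_ ^ _), one_div (_ ^ _), ← Real.rpow_neg hk.le,
    ← Real.rpow_natCast, ← Real.rpow_neg hk.le, ← Real.rpow_add hk]
  norm_num

theorem sum_range_bracket_eq_digamma {w : ℂ} (hw : ∀ n : ℕ, w ≠ -n) {k N : ℕ} (h : k < N) :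
    ∑ j ∈ Finset.range N, 1 / (w + j) - ∑ j ∈ Finset.range N, 1 / ((j : ℂ) - k) =
      Complex.digamma (1 + k) - Complex.digamma w +
        (Complex.digamma (w + N) - Complex.digamma (1 + (N - 1 - k : ℕ))) := by
  rw [sum_range_one_div_sub h, Complex.digamma_add_natCast hw N,
    Complex.digamma_add_natCast Complex.natCast_one_ne_neg k,
    Complex.digamma_add_natCast Complex.natCast_one_ne_neg (N - 1 - k)]
  ring

theorem tendsto_sum_range_bracket {w : ℂ} (hw : ∀ n : ℕ, w ≠ -n) (k : ℕ) :
    Tendsto (fun N : ℕ ↦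
        ∑ j ∈ Finset.range N, 1 / (w + j) - ∑ j ∈ Finset.range N, 1 / ((j : ℂ) - k))
      atTop (𝓝 (Complex.digamma (1 + k) - Complex.digamma w)) := by
  -- With `N + (k + 1)` in place of `N`, the truncated difference `N - 1 - k` becomes `N`, and the
  -- remainder is the digamma difference at `w + (k + 1)`.
  rw [← tendsto_add_atTop_iff_nat (k + 1)]
  have hw' (n : ℕ) : w + (k + 1 : ℕ) ≠ -n := fun h ↦
    hw (k + 1 + n) (by push_cast at h ⊢; linear_combination h)
  have := (tendsto_digamma_sub hw').const_add (Complex.digamma (1 + k) - Complex.digamma w)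
  rw [add_zero] at this
  refine this.congr fun N ↦ ?_
  rw [sum_range_bracket_eq_digamma hw (by omega), show N + (k + 1) - 1 - k = N by omega,
    Nat.cast_add N, add_assoc w, add_comm (N : ℂ)]

theorem exists_norm_sum_range_bracket_le {z : ℂ} (hz : ∀ n : ℕ, z ≠ -n) :
    ∃ C, ∀ k N : ℕ, k < N →
      ‖∑ j ∈ Finset.range N, 1 / (z + k + j) - ∑ j ∈ Finset.range N, 1 / ((j : ℂ) - k)‖ ≤
        C * √((k : ℝ) + 1) := by
  obtain ⟨c, hc, hcz⟩ := exists_pos_mul_le_norm_add_natCast hz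
  set D : ℝ := ‖1 - z‖ / c * ∑' n : ℕ, 1 / ((n : ℝ) + 1) ^ 2
  have hD : 0 ≤ D := mul_nonneg (by positivity) (tsum_nonneg fun n ↦ by positivity)
  -- `D` bounds the error of replacing `z` by `1`; the remaining harmonic block is at most `2 *
  -- √(2k+1) ≤ 4 * √(k+1)`.
  refine ⟨D + 4, fun k N h ↦ ?_⟩
  have hsplit : ∑ j ∈ Finset.range N, 1 / (z + k + j) - ∑ j ∈ Finset.range N, 1 / ((j : ℂ) - k) =
      ∑ j ∈ Finset.range N, (1 / (z + k + j) - 1 / (1 + k + j)) +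
        ((∑ j ∈ Finset.range (N + k), 1 / (1 + j : ℝ) -
          ∑ j ∈ Finset.range (N - 1 - k), 1 / (1 + j : ℝ) : ℝ) : ℂ) := by
    rw [sum_range_one_div_sub h, add_comm N k, Finset.sum_range_add, Finset.sum_sub_distrib]
    push_cast
    simp only [add_assoc]
    ring
  have hnn : 0 ≤ ∑ j ∈ Finset.range (N + k), 1 / (1 + j : ℝ) -
      ∑ j ∈ Finset.range (N - 1 - k), 1 / (1 + j : ℝ) :=
    sub_nonneg.2 (Finset.sum_le_sum_of_subset_of_nonneg
      (Finset.range_subset_range.2 (by omega)) fun j _ _ ↦ by positivity)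
  have hsqrt : √((2 * k + 1 : ℕ) : ℝ) ≤ 2 * √((k : ℝ) + 1) := by
    rw [Real.sqrt_le_left (by positivity), mul_pow, Real.sq_sqrt (by positivity)]
    push_cast
    linarith [(Nat.cast_nonneg k : (0 : ℝ) ≤ k)]
  have hone : 1 ≤ √((k : ℝ) + 1) := Real.one_le_sqrt.2 (by simp)
  rw [hsplit]
  refine (norm_add_le _ _).trans ?_
  rw [Complex.norm_real, Real.norm_of_nonneg hnn]
  have h1 := norm_sum_range_sub_le hc hcz k N
  have h2 := sum_range_sub_sum_range_le h
  have h3 := le_mul_of_one_le_right hD hone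
  linarith

/-! ### Passage to the limit -/

theorem mainTheorem12 (a : ℂ) (ha : ∀ n : ℕ, 2 * a ≠ -(n : ℂ)) (m : ℕ) (hm : 1 ≤ m) :
    HasSum
      (fun k : ℕ =>
        (Complex.digamma (1 + (k : ℂ)) - Complex.digamma (2 * a + (k : ℂ))) /
          (a + (k : ℂ)) ^ (2 * m + 1))
      (((m : ℂ) + 1 / 2) * hurwitzZetaInt (2 * m + 2) a
        - ∑ i ∈ Finset.Icc 1 m,
            hurwitzZetaInt (2 * i) a * hurwitzZetaInt (2 * m - 2 * i + 2) a) := by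
  have ha' (n : ℕ) : a ≠ -n := fun h ↦ ha (2 * n) (by push_cast; linear_combination 2 * h)
  have hadd (j k : ℕ) : (a + j) + (a + k) ≠ 0 := fun h ↦
    ha (j + k) (by push_cast; linear_combination h)
  have hinj : Function.Injective fun k : ℕ ↦ a + (k : ℂ) :=
    (add_right_injective a).comp Nat.cast_injective
  have hak (k n : ℕ) : 2 * a + k ≠ -n := fun h ↦
    ha (k + n) (by push_cast; linear_combination h)
  set S : ℕ → ℕ → ℂ := fun s N ↦ ∑ k ∈ Finset.range N, 1 / (a + k) ^ s
  set b : ℕ → ℕ → ℂ := fun N k ↦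
    ∑ j ∈ Finset.range N, 1 / (2 * a + k + j) - ∑ j ∈ Finset.range N, 1 / ((j : ℂ) - k)
  -- Extending by zero to `k ≥ N` turns the finite sum into a series over all `k`; the uniform bound
  -- on `b` is available only for `k < N`.
  set f : ℕ → ℕ → ℂ := fun N k ↦ if k < N then b N k / (a + k) ^ (2 * m + 1) else 0
  set g : ℕ → ℂ := fun k ↦
    (Complex.digamma (1 + k) - Complex.digamma (2 * a + k)) / (a + k) ^ (2 * m + 1)
  have hfg (k : ℕ) : Tendsto (f · k) atTop (𝓝 (g k)) := by
    refine ((tendsto_sum_range_bracket (hak k) k).div_const _).congr' ?_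
    filter_upwards [eventually_gt_atTop k] with N hN
    simp only [f, b, if_pos hN]
  obtain ⟨C, hC⟩ := exists_norm_sum_range_bracket_le ha
  obtain ⟨c, hc, hca⟩ := exists_pos_mul_le_norm_add_natCast ha'
  have hC0 : 0 ≤ C := by simpa using (norm_nonneg _).trans (hC 0 1 one_pos)
  have hbound (N k : ℕ) :
      ‖f N k‖ ≤ C / c ^ (2 * m + 1) * √((k : ℝ) + 1) * (1 / ((k : ℝ) + 1) ^ 3) := by
    by_cases h : k < N
    · simp only [f, if_pos h, norm_div, norm_pow]
      calc ‖b N k‖ / ‖a + k‖ ^ (2 * m + 1)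
          ≤ C * √((k : ℝ) + 1) / (c ^ (2 * m + 1) * ((k : ℝ) + 1) ^ 3) := by
            gcongr
            · exact hC k N h
            -- Here `m ≥ 1` enters: `2m + 1 ≥ 3` and `k + 1 ≥ 1`.
            · refine le_trans ?_ (pow_le_pow_left₀ (by positivity) (hca k) _)
              rw [mul_pow]
              gcongr
              · simp
              · omega
        _ = _ := by field_simp
    · simp only [f, if_neg h, norm_zero]
      positivity
  have hsum := summable_sqrt_mul_one_div_pow (C / c ^ (2 * m + 1))
  have hlim := tendsto_tsum_of_dominated_convergence hsum hfg (.of_forall hbound)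
  have hgs : Summable g :=
    hsum.of_norm_bounded fun k ↦ le_of_tendsto (hfg k).norm (.of_forall fun N ↦ hbound N k)
  have hfin (N : ℕ) : ∑' k, f N k = ((m : ℂ) + 1 / 2) * S (2 * m + 2) N -
      ∑ i ∈ Finset.Icc 1 m, S (2 * i) N * S (2 * m - 2 * i + 2) N := by
    rw [sum_mul_sum_inv_pow hadd hinj, tsum_eq_sum (s := Finset.range N) fun k hk ↦
      if_neg (by simpa using hk), sub_add_cancel_left, ← Finset.sum_neg_distrib]
    refine Finset.sum_congr rfl fun k hk ↦ ?_
    simp only [b, if_pos (Finset.mem_range.1 hk), add_sub_add_left_eq_sub]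
    have e (j : ℕ) : a + (k : ℂ) + (a + j) = 2 * a + k + j := by ring
    simp only [e]
    ring
  have hS {s : ℕ} (hs : 2 ≤ s) : Tendsto (S s) atTop (𝓝 (hurwitzZetaInt s a)) :=
    (hasSum_hurwitzZetaInt hs a).tendsto_sum_nat
  have hlim' := ((hS (s := 2 * m + 2) (by omega)).const_mul ((m : ℂ) + 1 / 2)).sub
    (tendsto_finsetSum (Finset.Icc 1 m) fun i hi ↦
      (hS (s := 2 * i) (by have := (Finset.mem_Icc.1 hi).1; omega)).mul
        (hS (s := 2 * m - 2 * i + 2) (by omega)))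
  rw [← tendsto_nhds_unique hlim (hlim'.congr fun N ↦ (hfin N).symm)]
  exact hgs.hasSum
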